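/- Let $0<e<1$, $\lambda>0$, $\mu>0$ and $a=\lambda^2/\mu$. For $\vec x=(x,y)\in\mathbb R^2$ with $r=\sqrt{x^2+y^2}$ put $$D=(er-x)^2+(1-e^2)y^2,$$ $$\alpha=\left(\tfrac12\sqrt{\frac{(er-x-4\lambda^2e/\mu)^2+(1-e^2)y^2}{D}}+\tfrac12\,\frac{(er-x-2\lambda^2e/\mu)^2+(1-e^2)y^2-4\lambda^4e^2/\mu^2}{D}\right)^{1/2},\qquad \beta=\frac{-2\lambda^2e\sqrt{1-e^2}\,y}{\mu D\alpha},$$ and let $\vec b=(b_x,b_y)$ be the drift $$b_x=\frac{\mu}{2\lambda}\left\{\frac{\alpha+\beta-1}{e}-(\alpha+\beta+1)\frac xr\right\},\qquad b_y=\frac{\mu}{2\lambda}\left\{(\alpha-\beta-1)\frac{\sqrt{1-e^2}}{e}-(\alpha+\beta+1)\frac yr\right\}.$$ It is smooth off the closure of the singularity $\Sigma=\{(x,0):-4ae/(1+e)<x<0\}$; on that closure it is given arbitrary fixed values. For $-e<c<1$ let $\mathcal E_c$ be the ellipse with semi-major axis $2ae/(e+c)$, eccentricity $|c|$, and foci $(0,0)$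 and $(-4aec/(e+c),0)$; its interior contains $\overline\Sigma$. Fix $0<\delta<1+e$ and consider $\mathcal E_{1-\delta}$ (for small $\delta$ a small ellipse around $\Sigma$). Let $t>0$, $\vec x\in\mathbb R^2$, let $\vec B$ be a standard planar Brownian motion on a probability space $(\Omega,\mathbb P)$, and let $(\epsilon_j)$ be a sequence of real numbers. Let $\vec X^{\epsilon_j}$ and $\vec X^0$ be processes with almost surely continuous paths which satisfy on $[0,t]$ $$d\vec X^{\epsilon_j}(s)=\vec b(\vec X^{\epsilon_j}(s))\,ds+\epsilon_j\,d\vec B(s),\quad \vec X^{\epsilon_j}(0)=\vec x;\qquad d\vec X^0(s)=\vec b(\vec X^0(s))\,ds,\quad \vec X^0(0)=\vec x,$$ and let $$A^j_t=\left\{\inf\{s>0:\vec X^{\epsilon_j}(s)\in\mathrm{int}(\mathcal E_{1-\delta})\}>t\right\}.$$ **Theorem.** Suppose $\sum_j\epsilon_j^2<\infty$. Then conditionally on $\vec X^{\epsilon_j}$ avoiding $\mathrm{int}(\mathcal E_{1-\delta})$ up to time $t$, $\vec X^{\epsilon_j}(s)\to\vec X^0(s)$ as $j\to\infty$, uniformly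 for $s\in(0,t)$, almost surely. That is: 1. For $\mathbb P$-almost every $\omega$, $\vec X^{\epsilon_j}(s)(\omega)\to\vec X^0(s)(\omega)$ uniformly in $s\in(0,t)$ as $j\to\infty$ along the indices $j$ with $\omega\in A^j_t$ (no assertion is made if there are only finitely many of them). 2. If the event $A=\{\omega:\omega\in A^j_t\text{ for all but finitely many }j\}$ has $\mathbb P(A)>0$, then $\mathbb P\left(\vec X^{\epsilon_j}(s)\to\vec X^0(s)\text{ as } j\to\infty,\text{ uniformly in }s\in(0,t)\,\middle|\,A\right)=1$. 3. If almost surely $\vec X^0(s)\notin\overline\Sigma$ for all $0\le s\le t$, then for every single $j$ with $\mathbb P(A^j_t)>0$, $\mathbb P\left(\vec X^{\epsilon_k}(s)\to\vec X^0(s)\text{ as } k\to\infty,\text{ uniformly in }s\in(0,t)\,\middle|\,A^j_t\right)=1$. -/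

import Mathlib

open MeasureTheory ProbabilityTheory Filter Set
open scoped NNReal ENNReal Topology

noncomputable section

namespace KeplerDiffusion

/-- The plane of motion, with its Euclidean norm. -/
abbrev Plane : Type := EuclideanSpace ℝ (Fin 2)

/-- The semi-major axis `a = λ² / μ` of the Kepler ellipse. -/
def semiMajor (lam mu : ℝ) : ℝ := lam ^ 2 / mu

/-- The common denominator `(e √(x² + y²) - x)² + (1 - e²) y²` of `α` and `β`;
it vanishes only at the origin. -/
def den (e : ℝ) (p : Plane) : ℝ :=
  (e * √(p 0 ^ 2 + p 1 ^ 2) - p 0) ^ 2 + (1 - e ^ 2) * p 1 ^ 2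

/-- The function `α`, the real part of `√(1 - 4/ν)`. -/
def alpha (e lam mu : ℝ) (p : Plane) : ℝ :=
  √((1 / 2) * √(((e * √(p 0 ^ 2 + p 1 ^ 2) - p 0 - 4 * lam ^ 2 * e / mu) ^ 2
          + (1 - e ^ 2) * p 1 ^ 2) / den e p)
    + (1 / 2) * (((e * √(p 0 ^ 2 + p 1 ^ 2) - p 0 - 2 * lam ^ 2 * e / mu) ^ 2
          + (1 - e ^ 2) * p 1 ^ 2 - 4 * lam ^ 4 * e ^ 2 / mu ^ 2) / den e p))

/-- The function `β`, the imaginary part of `√(1 - 4/ν)`.  (At the points of the closed drift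
singularity, where `α = 0` or the formulas are not defined, Lean's division by zero
gives an arbitrary value.) -/
def beta (e lam mu : ℝ) (p : Plane) : ℝ :=
  (-2 * lam ^ 2 * e * √(1 - e ^ 2) * p 1) / (mu * den e p * alpha e lam mu p)

/-- The drift `b = (b_x, b_y)` of the limiting Nelson diffusion in the plane of motion. -/
def drift (e lam mu : ℝ) (p : Plane) : Plane :=
  !₂[mu / (2 * lam) *
      ((alpha e lam mu p + beta e lam mu p - 1) * (1 / e)
        - (alpha e lam mu p + beta e lam mu p + 1) * (p 0 / √(p 0 ^ 2 + p 1 ^ 2))),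
    mu / (2 * lam) *
      ((alpha e lam mu p - beta e lam mu p - 1) * (√(1 - e ^ 2) / e)
        - (alpha e lam mu p + beta e lam mu p + 1) * (p 1 / √(p 0 ^ 2 + p 1 ^ 2)))]

/-- The drift singularity `Σ`: the open segment from `(-4ae/(1+e), 0)` to the origin. -/
def singularity (e lam mu : ℝ) : Set Plane :=
  {p | p 1 = 0 ∧ -(4 * semiMajor lam mu * e / (1 + e)) < p 0 ∧ p 0 < 0}

/-- The interior of the ellipse `ℰ_c` (`-e < c < 1`), which has semi-major axis `2ae/(e+c)`,
eccentricity `|c|`, and foci `(0,0)` and `(-4aec/(e+c), 0)`: the points whose distances to the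
two foci add up to less than the major axis. -/
def intEllipse (e lam mu c : ℝ) : Set Plane :=
  {p | dist p 0 + dist p !₂[-(4 * semiMajor lam mu * e * c / (e + c)), 0]
        < 2 * (2 * semiMajor lam mu * e / (e + c))}

variable {Ω : Type*} [MeasurableSpace Ω]

/-- `B` is a standard Brownian motion in the plane, started at the origin: its two coordinates
are independent standard real Brownian motions. -/
structure IsPlanarBrownian (B : ℝ≥0 → Ω → Plane) (P : Measure Ω) : Prop where
  coord : ∀ i, IsBrownianReal (fun s ω => B s ω i) P
  indep : iIndepFun (fun (i : Fin 2) ω (s : ℝ≥0) => B s ω i) P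

/-- `X` is a process with almost surely continuous paths which satisfies
`dX(s) = b(X(s)) ds + ε dB(s)` for `0 ≤ s ≤ t`, and `X(0) = x`, where `b` is the limiting
Nelson drift.  The noise is additive, so the equation is the pathwise integral equation. -/
structure IsLimitingDiffusion (e lam mu eps : ℝ) (B : ℝ≥0 → Ω → Plane) (P : Measure Ω)
    (x : Plane) (t : ℝ≥0) (X : ℝ≥0 → Ω → Plane) : Prop where
  aemeasurable : ∀ s, AEMeasurable (X s) P
  continuous_paths : ∀ᵐ ω ∂P, Continuous fun s => X s ω
  integrable_drift : ∀ᵐ ω ∂P,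
    IntervalIntegrable (fun u : ℝ => drift e lam mu (X u.toNNReal ω)) volume 0 t
  equation : ∀ᵐ ω ∂P, ∀ s ≤ t,
    X s ω = x + (∫ u in (0 : ℝ)..s, drift e lam mu (X u.toNNReal ω)) + eps • B s ω

/-- The first hitting time `inf {s > 0 : X(s) ∈ G}`, equal to `∞` if there is no such `s`. -/
def firstHit (X : ℝ≥0 → Ω → Plane) (G : Set Plane) (ω : Ω) : ℝ≥0∞ :=
  ⨅ (s : ℝ≥0) (_ : 0 < s ∧ X s ω ∈ G), (s : ℝ≥0∞)

/-- The event that the first hitting time of the interior of `ℰ_{1-δ}` is larger than `t`. -/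
def avoidEvent (e lam mu δ : ℝ) (t : ℝ≥0) (X : ℝ≥0 → Ω → Plane) : Set Ω :=
  {ω | (t : ℝ≥0∞) < firstHit X (intEllipse e lam mu (1 - δ)) ω}

end KeplerDiffusion

end

/-! The noise is additive and one Brownian motion drives every equation, so the problem is
deterministic, path by path: Brownian paths are bounded on `[0, t]`, and square-summability is
needed only to give `eps j → 0`. While the limit path stays off the closed singularity, the drift is
Lipschitz on a compact tube around it, and a Grönwall argument gives uniform convergence
(`tendstoUniformlyOn_of_integral_equation`). Avoidance for infinitely many `j` forces the limit path
off the singularity: before a first hit convergence holds, so the limit lies in the closed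
complement of the ellipse interior; by continuity so does the hitting point, which is absurd since
the singularity lies inside (`notMem_of_frequently_avoid`). What remains is the geometry of the
segment and the regularity of the drift off it (`contDiffAt_drift`). -/

namespace KeplerDiffusion

/-! ### Pathwise stability of integral equations. -/

section Deterministic

variable {E : Type*} [NormedAddCommGroup E] [NormedSpace ℝ E]

/-- A strict exponential comparison bound for two solutions of an integral equation, valid as long
as it keeps the second path in a region where the vector field is Lipschitz. -/
theorem norm_sub_lt_mul_exp {v : E → E} {S : Set E} {K t : ℝ≥0} (hK : LipschitzOnWith K v S)
    {f g r : ℝ≥0 → E} (hf : Continuous f) (hg : Continuous g) {ρ η C : ℝ}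
    (hS : ∀ s ≤ t, Metric.closedBall (f s) ρ ⊆ S) (hη0 : 0 ≤ η) (hηC : η < C)
    (hCρ : C * Real.exp (K * t) ≤ ρ)
    (hfi : IntervalIntegrable (fun u : ℝ => v (f u.toNNReal)) volume 0 t)
    (hgi : IntervalIntegrable (fun u : ℝ => v (g u.toNNReal)) volume 0 t)
    (hfg : ∀ s ≤ t, g s - f s = (∫ u in (0 : ℝ)..s, v (g u.toNNReal))
      - (∫ u in (0 : ℝ)..s, v (f u.toNNReal)) + r s)
    (hr : ∀ s ≤ t, ‖r s‖ ≤ η) :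
    ∀ s ≤ t, ‖g s - f s‖ < C * Real.exp (K * s) := by
  have hC : 0 < C := hη0.trans_lt hηC
  by_contra! hcon
  -- Consider the first time at which the bound fails: before it the paths stay within `ρ`, and the
  -- integral estimate then beats the bound by `C - η > 0`.
  let T : Set ℝ≥0 := Icc 0 t ∩ {s | C * Real.exp (K * s) ≤ ‖g s - f s‖}
  have hTc : IsCompact T :=
    isCompact_Icc.inter_right (isClosed_le (by fun_prop) (by fun_prop))
  have hTn : T.Nonempty := by
    obtain ⟨s, hs, h⟩ := hcon
    exact ⟨s, ⟨zero_le, hs⟩, h⟩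
  obtain ⟨s, ⟨⟨-, hst⟩, hs⟩, hmin⟩ := hTc.exists_isLeast hTn
  have hbelow : ∀ u < s, ‖g u - f u‖ < C * Real.exp (K * u) := by
    intro u hu
    by_contra! h
    exact absurd (hmin ⟨⟨zero_le, hu.le.trans hst⟩, h⟩) (not_le.2 hu)
  have hsub : uIcc (0 : ℝ) s ⊆ uIcc (0 : ℝ) t := by
    rw [uIcc_of_le s.coe_nonneg, uIcc_of_le t.coe_nonneg]
    exact Icc_subset_Icc_right (by exact_mod_cast hst)
  have hbound : ‖∫ u in (0 : ℝ)..s, (v (g u.toNNReal) - v (f u.toNNReal))‖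
      ≤ ∫ u in (0 : ℝ)..s, C * (Real.exp (K * u) * K) := by
    apply intervalIntegral.norm_integral_le_of_norm_le s.2
    -- The strict bound is known only before `s`, so the endpoint is discarded as a null set.
    · filter_upwards [compl_mem_ae_iff.2 (measure_singleton (μ := volume) (s : ℝ))] with u hu hu'
      have hus : u.toNNReal < s := by
        rw [Real.toNNReal_lt_iff_lt_coe hu'.1.le]
        exact lt_of_le_of_ne hu'.2 hu
      have hlt := hbelow _ hus
      have hut : u.toNNReal ≤ t := hus.le.trans hst
      have hexp : Real.exp (K * (u.toNNReal : ℝ)) ≤ Real.exp (K * t) := by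
        apply Real.exp_le_exp.2
        exact mul_le_mul_of_nonneg_left (by exact_mod_cast hut) K.2
      have hmem : g u.toNNReal ∈ Metric.closedBall (f u.toNNReal) ρ := by
        rw [Metric.mem_closedBall, dist_eq_norm]
        exact hlt.le.trans ((mul_le_mul_of_nonneg_left hexp hC.le).trans hCρ)
      have hρ : 0 ≤ ρ := (by positivity : (0 : ℝ) ≤ C * Real.exp (K * t)).trans hCρ
      have hlip := hK.dist_le_mul _ (hS _ hut hmem) _ (hS _ hut (Metric.mem_closedBall_self hρ))
      rw [dist_eq_norm, dist_eq_norm] at hlip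
      rw [Real.coe_toNNReal _ hu'.1.le] at hlt
      calc ‖v (g u.toNNReal) - v (f u.toNNReal)‖ ≤ K * ‖g u.toNNReal - f u.toNNReal‖ := hlip
        _ ≤ K * (C * Real.exp (K * u)) := mul_le_mul_of_nonneg_left hlt.le K.2
        _ = C * (Real.exp (K * u) * K) := by ring
    · exact Continuous.intervalIntegrable (by fun_prop) _ _
  have hint : ∫ u in (0 : ℝ)..s, C * (Real.exp (K * u) * K) = C * Real.exp (K * s) - C := by
    have hderiv : ∀ u ∈ uIcc (0 : ℝ) s,
        HasDerivAt (fun u : ℝ => C * Real.exp (K * u)) (C * (Real.exp (K * u) * K)) u := by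
      intro u _
      have h := ((hasDerivAt_id u).const_mul (K : ℝ)).exp.const_mul C
      simpa using h
    rw [intervalIntegral.integral_eq_sub_of_hasDerivAt hderiv
      (Continuous.intervalIntegrable (by fun_prop) _ _)]
    simp
  rw [hint, intervalIntegral.integral_sub (hgi.mono_set hsub) (hfi.mono_set hsub)] at hbound
  have hs' : C * Real.exp (K * s) ≤ ‖g s - f s‖ := hs
  rw [hfg s hst] at hs'
  have := norm_add_le ((∫ u in (0 : ℝ)..s, v (g u.toNNReal))
      - (∫ u in (0 : ℝ)..s, v (f u.toNNReal))) (r s)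
  linarith [hr s hst]

/-- If the limit path stays in an open set on which the vector field is locally Lipschitz, then
solutions with a vanishing bounded perturbation converge to it uniformly. -/
theorem tendstoUniformlyOn_of_integral_equation [ProperSpace E] {v : E → E} {U : Set E}
    (hU : IsOpen U) (hv : LocallyLipschitzOn U v) {t : ℝ≥0} {x : E} {w : ℝ≥0 → E}
    (hw : Continuous w) {eps : ℕ → ℝ} (heps : Tendsto eps atTop (𝓝 0))
    {f : ℝ≥0 → E} (hf : Continuous f)
    (hfi : IntervalIntegrable (fun u : ℝ => v (f u.toNNReal)) volume 0 t)
    (hfe : ∀ s ≤ t, f s = x + ∫ u in (0 : ℝ)..s, v (f u.toNNReal))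
    (hfU : ∀ s ≤ t, f s ∈ U)
    {g : ℕ → ℝ≥0 → E} (hg : ∀ j, Continuous (g j))
    (hgi : ∀ j, IntervalIntegrable (fun u : ℝ => v (g j u.toNNReal)) volume 0 t)
    (hge : ∀ j, ∀ s ≤ t, g j s = x + (∫ u in (0 : ℝ)..s, v (g j u.toNNReal)) + eps j • w s) :
    TendstoUniformlyOn g f atTop (Iic t) := by
  have hIc : IsCompact (Icc 0 t) := isCompact_Icc
  have hfc : IsCompact (f '' Icc 0 t) := hIc.image hf
  obtain ⟨ρ, hρ, hρU⟩ := hfc.exists_cthickening_subset_open hU (by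
    rintro _ ⟨s, hs, rfl⟩
    exact hfU s hs.2)
  obtain ⟨K, hK⟩ := LocallyLipschitzOn.exists_lipschitzOnWith_of_compact
    (hfc.cthickening (r := ρ)) (hv.mono hρU)
  obtain ⟨M, hM⟩ := hIc.exists_bound_of_continuousOn hw.continuousOn
  have hS : ∀ s ≤ t, Metric.closedBall (f s) ρ ⊆ Metric.cthickening ρ (f '' Icc 0 t) :=
    fun s hs => Metric.closedBall_subset_cthickening (mem_image_of_mem f (mem_Icc.2 ⟨zero_le, hs⟩)) ρ
  rw [Metric.tendstoUniformlyOn_iff]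
  intro ε hε
  have hexp : 0 < Real.exp (K * t) := Real.exp_pos _
  -- With this `C` the bound at time `t` is `min ρ ε`: `ρ` keeps the path in the tube, `ε` is the
  -- required closeness.
  set C : ℝ := min ρ ε / Real.exp (K * t) with hCdef
  have hC : 0 < C := div_pos (lt_min hρ hε) hexp
  have hCexp : C * Real.exp (K * t) = min ρ ε := div_mul_cancel₀ _ hexp.ne'
  have hη : ∀ᶠ j in atTop, |eps j| * M < C := by
    have h : Tendsto (fun j => |eps j| * M) atTop (𝓝 0) := by
      simpa using heps.abs.mul_const M
    exact h.eventually_lt_const hC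
  filter_upwards [hη] with j hj s hs
  have hM0 : 0 ≤ M := (norm_nonneg _).trans (hM 0 (left_mem_Icc.2 zero_le))
  have hlt := norm_sub_lt_mul_exp (r := fun s => eps j • w s) hK hf (hg j) hS
    (by positivity) hj (hCexp.trans_le (min_le_left _ _)) hfi (hgi j)
    (fun s hs => by rw [hge j s hs, hfe s hs]; abel)
    (fun s hs => by
      rw [norm_smul, Real.norm_eq_abs]
      exact mul_le_mul_of_nonneg_left (hM s ⟨zero_le, hs⟩) (abs_nonneg _)) s hs
  rw [dist_comm, dist_eq_norm]
  refine hlt.trans_le (le_trans ?_ (min_le_right ρ ε))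
  rw [← hCexp]
  refine mul_le_mul_of_nonneg_left (Real.exp_le_exp.2 ?_) hC.le
  exact mul_le_mul_of_nonneg_left (by exact_mod_cast hs) K.2

/-- If infinitely many of the perturbed paths avoid, during `(0, t]`, an open set containing the
closed singular set of the vector field, then the limit path does not meet the singular set. -/
theorem notMem_of_frequently_avoid [ProperSpace E] {v : E → E} {S G : Set E}
    (hS : IsClosed S) (hG : IsOpen G) (hSG : S ⊆ G) (hv : LocallyLipschitzOn Sᶜ v)
    {t : ℝ≥0} (ht : 0 < t) {x : E} {w : ℝ≥0 → E}
    (hw : Continuous w) (hw0 : w 0 = 0) {eps : ℕ → ℝ} (heps : Tendsto eps atTop (𝓝 0))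
    {f : ℝ≥0 → E} (hf : Continuous f)
    (hfi : IntervalIntegrable (fun u : ℝ => v (f u.toNNReal)) volume 0 t)
    (hfe : ∀ s ≤ t, f s = x + ∫ u in (0 : ℝ)..s, v (f u.toNNReal))
    {g : ℕ → ℝ≥0 → E} (hg : ∀ j, Continuous (g j))
    (hgi : ∀ j, IntervalIntegrable (fun u : ℝ => v (g j u.toNNReal)) volume 0 t)
    (hge : ∀ j, ∀ s ≤ t, g j s = x + (∫ u in (0 : ℝ)..s, v (g j u.toNNReal)) + eps j • w s)
    (havoid : ∃ᶠ j in atTop, ∀ s, 0 < s → s ≤ t → g j s ∉ G) :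
    ∀ s ≤ t, f s ∉ S := by
  -- Avoidance is assumed only for positive times; since `Gᶜ` is closed, letting `s ↓ 0` adds time
  -- `0`.
  have havoid' : ∃ᶠ j in atTop, ∀ s ≤ t, g j s ∉ G := by
    refine havoid.mono fun j hj s hs => ?_
    rcases eq_or_ne s 0 with rfl | h0
    · have hcl : IsClosed {s | g j s ∈ Gᶜ} := hG.isClosed_compl.preimage (hg j)
      have hmem : (0 : ℝ≥0) ∈ closure (Ioc 0 t) := by
        rw [closure_Ioc ht.ne]
        exact ⟨le_rfl, zero_le⟩
      exact closure_minimal (fun s hs => hj s hs.1 hs.2) hcl hmem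
    · exact hj s (pos_iff_ne_zero.2 h0) hs
  by_contra! hcon
  have hTc : IsCompact (Icc 0 t ∩ f ⁻¹' S) := isCompact_Icc.inter_right (hS.preimage hf)
  obtain ⟨τ, ⟨⟨-, hτt⟩, hτ⟩, hmin⟩ := hTc.exists_isLeast (by
    obtain ⟨s, hs, h⟩ := hcon
    exact ⟨s, ⟨zero_le, hs⟩, h⟩)
  have hbelow : ∀ s < τ, f s ∈ Gᶜ := by
    intro s hs
    have hst : s ≤ t := hs.le.trans hτt
    have hsub : uIcc (0 : ℝ) s ⊆ uIcc (0 : ℝ) t := by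
      rw [uIcc_of_le s.coe_nonneg, uIcc_of_le t.coe_nonneg]
      exact Icc_subset_Icc_right (by exact_mod_cast hst)
    have hconv := tendstoUniformlyOn_of_integral_equation hS.isOpen_compl hv hw heps hf
      (hfi.mono_set hsub) (fun u hu => hfe u (hu.trans hst))
      (fun u hu h => absurd (hmin ⟨⟨zero_le, hu.trans hst⟩, h⟩) (not_le.2 (hu.trans_lt hs)))
      hg (fun j => (hgi j).mono_set hsub) (fun j u hu => hge j u (hu.trans hst))
    exact hG.isClosed_compl.mem_of_frequently_of_tendsto (havoid'.mono fun j hj => hj s hst)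
      (hconv.tendsto_at (mem_Iic.2 le_rfl))
  -- If `τ = 0` there are no earlier times, but all paths share the starting point `x`.
  rcases eq_or_ne τ 0 with rfl | hτ0
  · obtain ⟨j, hj⟩ := havoid'.exists
    have h1 := hj 0 zero_le
    rw [hge j 0 zero_le, hw0] at h1
    have h2 : f 0 ∈ S := hτ
    rw [hfe 0 zero_le] at h2
    simp only [NNReal.coe_zero, intervalIntegral.integral_same, add_zero, smul_zero] at h1 h2
    exact h1 (hSG h2)
  · have hmem : τ ∈ closure (Iio τ) := by
      rw [closure_Iio' ⟨0, pos_iff_ne_zero.2 hτ0⟩]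
      exact mem_Iic.2 le_rfl
    exact closure_minimal hbelow (hG.isClosed_compl.preimage hf) hmem (hSG hτ)

end Deterministic

/-! ### The singular segment and the ellipses. -/

/-- The closed segment from `(-4ae/(1+e), 0)` to the origin. -/
def closedSingularity (e lam mu : ℝ) : Set Plane :=
  {p | p 1 = 0 ∧ -(4 * semiMajor lam mu * e / (1 + e)) ≤ p 0 ∧ p 0 ≤ 0}

theorem isClosed_closedSingularity (e lam mu : ℝ) : IsClosed (closedSingularity e lam mu) := by
  refine IsClosed.and (isClosed_eq (by fun_prop) (by fun_prop)) (IsClosed.and ?_ ?_)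
  · exact isClosed_le (by fun_prop) (by fun_prop)
  · exact isClosed_le (by fun_prop) (by fun_prop)

theorem closedSingularity_subset_closure {e lam mu : ℝ} (he : 0 < e) (hlam : 0 < lam)
    (hmu : 0 < mu) : closedSingularity e lam mu ⊆ closure (singularity e lam mu) := by
  have ha : 0 < 4 * semiMajor lam mu * e / (1 + e) := by unfold semiMajor; positivity
  rintro p ⟨hp1, hp0⟩
  let φ : ℝ → Plane := fun c => !₂[c, 0]
  have hφ : Continuous φ := by
    refine (PiLp.continuous_toLp 2 _).comp (continuous_pi fun i => ?_)
    fin_cases i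
    · exact continuous_id
    · exact continuous_const
  have hpφ : p = φ (p 0) := by
    ext i
    fin_cases i
    · simp [φ]
    · simpa [φ] using hp1
  rw [hpφ]
  have hmem : p 0 ∈ closure (Ioo (-(4 * semiMajor lam mu * e / (1 + e))) 0) := by
    rw [closure_Ioo (by linarith)]
    exact hp0
  refine closure_mono ?_ (image_closure_subset_closure_image hφ (mem_image_of_mem φ hmem))
  rintro _ ⟨c, hc, rfl⟩
  exact ⟨by simp [φ], by simpa [φ] using hc.1, by simpa [φ] using hc.2⟩

theorem isOpen_intEllipse (e lam mu c : ℝ) : IsOpen (intEllipse e lam mu c) :=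
  isOpen_lt (by fun_prop) (by fun_prop)

theorem dist_of_apply_one_eq {p q : Plane} (h : p 1 = q 1) : dist p q = |p 0 - q 0| := by
  rw [EuclideanSpace.dist_eq, Fin.sum_univ_two, h]
  simp [Real.dist_eq, Real.sqrt_sq_eq_abs]

/-- With major axis `k`, the distances from a point of the segment to the foci sum to `k * c` or to
`-2 * p 0 - k * c`. The first is below `k` as `c < 1`; the second because `(1 + e) * (1 + c) - 2 *
(e + c) = (1 - e) * (1 - c) > 0`. -/
theorem closedSingularity_subset_intEllipse {e lam mu c : ℝ} (he0 : 0 < e) (he1 : e < 1)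
    (hlam : 0 < lam) (hmu : 0 < mu) (hc0 : -e < c) (hc1 : c < 1) :
    closedSingularity e lam mu ⊆ intEllipse e lam mu c := by
  have ha : 0 < semiMajor lam mu := by unfold semiMajor; positivity
  rintro p ⟨hp1, hp, hp0⟩
  have hec : 0 < e + c := by linarith
  have h1e : 0 < 1 + e := by linarith
  set k : ℝ := 4 * semiMajor lam mu * e / (e + c) with hk
  have hk0 : 0 < k := by positivity
  have hfoc : 4 * semiMajor lam mu * e * c / (e + c) = k * c := by rw [hk]; ring
  have hmaj : 2 * (2 * semiMajor lam mu * e / (e + c)) = k := by rw [hk]; ring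
  have hend : 4 * semiMajor lam mu * e / (1 + e) = k * ((e + c) / (1 + e)) := by
    rw [hk]; field_simp
  have hlt : 2 * ((e + c) / (1 + e)) < 1 + c := by
    rw [← mul_div_assoc, div_lt_iff₀ h1e]
    nlinarith [mul_pos (sub_pos.2 he1) (sub_pos.2 hc1)]
  change dist p 0 + dist p !₂[-(4 * semiMajor lam mu * e * c / (e + c)), 0] < _
  rw [hmaj, hfoc, dist_of_apply_one_eq (by simpa using hp1),
    dist_of_apply_one_eq (by simpa using hp1)]
  rw [hend] at hp
  simp only [PiLp.zero_apply, sub_zero, Matrix.cons_val_zero, sub_neg_eq_add]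
  rw [abs_of_nonpos hp0]
  have h1 := mul_lt_mul_of_pos_left hlt hk0
  have h2 := mul_lt_mul_of_pos_left hc1 hk0
  rcases abs_cases (p 0 + k * c) with ⟨h, -⟩ | ⟨h, -⟩ <;> rw [h] <;> nlinarith

/-! ### Smoothness of the drift off the segment. -/

/-- Positivity of `|z| + Re z` for `z = (w - 4k) / w`, `w = u + i √q`, off the cut `[0, 4k]`. -/
theorem sqrt_div_add_div_pos {u q k : ℝ} (hk : 0 < k) (hq : 0 ≤ q)
    (h : q = 0 → u < 0 ∨ 4 * k < u) :
    0 < u ^ 2 + q ∧ 0 < (u - 4 * k) ^ 2 + q ∧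
      0 < (1 / 2) * √(((u - 4 * k) ^ 2 + q) / (u ^ 2 + q))
        + (1 / 2) * (((u - 2 * k) ^ 2 + q - 4 * k ^ 2) / (u ^ 2 + q)) := by
  rcases hq.eq_or_lt with hq0 | hq0
  · have hu := h hq0.symm
    subst hq0
    have h1 : 0 < u ^ 2 := by rcases hu with hu | hu <;> nlinarith
    have h2 : 0 < (u - 4 * k) ^ 2 := by rcases hu with hu | hu <;> nlinarith
    have h3 : 0 < (u - 2 * k) ^ 2 + 0 - 4 * k ^ 2 := by rcases hu with hu | hu <;> nlinarith
    refine ⟨by linarith, by linarith, ?_⟩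
    have : 0 < ((u - 2 * k) ^ 2 + 0 - 4 * k ^ 2) / (u ^ 2 + 0) := div_pos h3 (by linarith)
    positivity
  · have hD : 0 < u ^ 2 + q := by positivity
    have hN : 0 < (u - 4 * k) ^ 2 + q := by positivity
    refine ⟨hD, hN, ?_⟩
    -- This is `(Re z)² < |z|²`; the gap is `(Im z)² = 16k²q / (u² + q)²`.
    have hlt : (((u - 2 * k) ^ 2 + q - 4 * k ^ 2) / (u ^ 2 + q)) ^ 2
        < ((u - 4 * k) ^ 2 + q) / (u ^ 2 + q) := by
      rw [div_pow, div_lt_div_iff₀ (by positivity) hD]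
      have : 0 < 16 * k ^ 2 * q * (u ^ 2 + q) := by positivity
      nlinarith
    have := (abs_lt.1 ((Real.lt_sqrt (abs_nonneg _)).2 (by rwa [sq_abs]))).1
    linarith

theorem contDiffAt_drift {e lam mu : ℝ} (he0 : 0 < e) (he1 : e < 1) (hlam : 0 < lam)
    (hmu : 0 < mu) {p : Plane} (hp : p ∉ closedSingularity e lam mu) :
    ContDiffAt ℝ 1 (drift e lam mu) p := by
  have h1e : 0 < 1 + e := by linarith
  have hk : 0 < lam ^ 2 * e / mu := by positivity
  have he2 : 0 < 1 - e ^ 2 := by nlinarith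
  set k := lam ^ 2 * e / mu with hkdef
  have hend : 4 * semiMajor lam mu * e / (1 + e) = 4 * k / (1 + e) := by
    unfold semiMajor; rw [hkdef]; ring
  have hr : p 0 ^ 2 + p 1 ^ 2 ≠ 0 := by
    intro h
    have h0 : p 0 = 0 := by nlinarith [sq_nonneg (p 0), sq_nonneg (p 1)]
    have h1 : p 1 = 0 := by nlinarith [sq_nonneg (p 0), sq_nonneg (p 1)]
    refine hp ⟨h1, ?_, h0.le⟩
    rw [h0, hend]
    have : 0 < 4 * k / (1 + e) := by positivity
    linarith
  -- On the axis `u = e|x| - x` equals `-(1 + e)x` for `x ≤ 0` and is negative for `x > 0`, so the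
  -- cut `0 ≤ u ≤ 4k` is exactly the closed segment.
  have hcut : (1 - e ^ 2) * p 1 ^ 2 = 0 →
      e * √(p 0 ^ 2 + p 1 ^ 2) - p 0 < 0 ∨ 4 * k < e * √(p 0 ^ 2 + p 1 ^ 2) - p 0 := by
    intro h
    have h1 : p 1 = 0 := by simpa [he2.ne'] using h
    rw [h1, zero_pow two_ne_zero, add_zero, Real.sqrt_sq_eq_abs]
    rcases le_or_gt (p 0) 0 with h0 | h0
    · right
      have h2 : p 0 < -(4 * k / (1 + e)) := by
        by_contra! h2
        exact hp ⟨h1, by rwa [hend], h0⟩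
      rw [abs_of_nonpos h0]
      have h3 : 4 * k / (1 + e) < -p 0 := by linarith
      rw [div_lt_iff₀ h1e] at h3
      linarith
    · left
      rw [abs_of_pos h0]
      nlinarith
  obtain ⟨hD, hN, hA⟩ := sqrt_div_add_div_pos hk (by positivity) hcut
  have e4 : 4 * lam ^ 2 * e / mu = 4 * k := by rw [hkdef]; ring
  have e2 : 2 * lam ^ 2 * e / mu = 2 * k := by rw [hkdef]; ring
  have e5 : 4 * lam ^ 4 * e ^ 2 / mu ^ 2 = 4 * k ^ 2 := by rw [hkdef]; ring
  have hden : ContDiffAt ℝ 1 (den e) p := by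
    unfold den
    fun_prop (disch := assumption)
  have hdne : den e p ≠ 0 := hD.ne'
  have hin : ((e * √(p 0 ^ 2 + p 1 ^ 2) - p 0 - 4 * k) ^ 2
      + (1 - e ^ 2) * p 1 ^ 2) / den e p ≠ 0 := (div_pos hN hD).ne'
  have hout : (1 / 2) * √(((e * √(p 0 ^ 2 + p 1 ^ 2) - p 0 - 4 * k) ^ 2
          + (1 - e ^ 2) * p 1 ^ 2) / den e p)
    + (1 / 2) * (((e * √(p 0 ^ 2 + p 1 ^ 2) - p 0 - 2 * k) ^ 2
          + (1 - e ^ 2) * p 1 ^ 2 - 4 * k ^ 2) / den e p) ≠ 0 := hA.ne'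
  have halpha : ContDiffAt ℝ 1 (alpha e lam mu) p := by
    unfold alpha
    rw [e4, e2, e5]
    fun_prop (disch := assumption)
  have hane : alpha e lam mu p ≠ 0 := by
    unfold alpha
    rw [e4, e2, e5]
    exact (Real.sqrt_pos.2 hA).ne'
  have hbne : mu * den e p * alpha e lam mu p ≠ 0 := mul_ne_zero (mul_ne_zero hmu.ne' hdne) hane
  have hbeta : ContDiffAt ℝ 1 (beta e lam mu) p := by
    unfold beta
    fun_prop (disch := assumption)
  have hsne : √(p 0 ^ 2 + p 1 ^ 2) ≠ 0 :=
    (Real.sqrt_pos.2 (lt_of_le_of_ne (by positivity) hr.symm)).ne'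
  rw [contDiffAt_euclidean]
  intro i
  fin_cases i
  · simp only [drift, Fin.zero_eta, PiLp.toLp_apply, Matrix.cons_val_zero]
    fun_prop (disch := assumption)
  · simp only [drift, Fin.mk_one, PiLp.toLp_apply, Matrix.cons_val_one, Matrix.cons_val_fin_one]
    fun_prop (disch := assumption)

theorem locallyLipschitzOn_drift {e lam mu : ℝ} (he0 : 0 < e) (he1 : e < 1) (hlam : 0 < lam)
    (hmu : 0 < mu) : LocallyLipschitzOn (closedSingularity e lam mu)ᶜ (drift e lam mu) := by
  intro p hp
  obtain ⟨K, s, hs, h⟩ := (contDiffAt_drift he0 he1 hlam hmu hp).exists_lipschitzOnWith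
  exact ⟨K, s, mem_nhdsWithin_of_mem_nhds hs, h⟩

theorem notMem_of_mem_avoidEvent {Ω : Type*} {e lam mu δ : ℝ} {t : ℝ≥0} {X : ℝ≥0 → Ω → Plane} {ω : Ω}
    (h : ω ∈ avoidEvent e lam mu δ t X) {s : ℝ≥0} (hs0 : 0 < s) (hst : s ≤ t) :
    X s ω ∉ intEllipse e lam mu (1 - δ) := by
  intro hs
  have h1 : firstHit X (intEllipse e lam mu (1 - δ)) ω ≤ s := iInf₂_le s ⟨hs0, hs⟩
  exact absurd ((show (t : ℝ≥0∞) < _ from h).trans_le h1) (by simpa using hst)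

/-! ### Brownian paths and conditioning. -/

variable {Ω : Type*} [MeasurableSpace Ω]

theorem IsPlanarBrownian.continuous_paths {B : ℝ≥0 → Ω → Plane} {P : Measure Ω}
    (hB : IsPlanarBrownian B P) : ∀ᵐ ω ∂P, Continuous fun s => B s ω := by
  filter_upwards [ae_all_iff.2 fun i => (hB.coord i).cont] with ω h
  exact (PiLp.continuous_toLp 2 _).comp (continuous_pi h)

theorem IsPlanarBrownian.apply_zero {B : ℝ≥0 → Ω → Plane} {P : Measure Ω}
    (hB : IsPlanarBrownian B P) : ∀ᵐ ω ∂P, B 0 ω = 0 := by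
  filter_upwards [hB.continuous_paths, ae_all_iff.2 fun i => (hB.coord i).tendsto_nhds_zero]
    with ω hc h
  ext i
  have hci : Continuous fun s => B s ω i := by fun_prop
  simpa using tendsto_nhds_unique (hci.tendsto 0) (h i)

/-- A set that contains a non-null conditioning event, up to a null set, has conditional
probability one; neither set has to be measurable. -/
theorem cond_eq_one_of_ae {P : Measure Ω} [IsFiniteMeasure P] {A S : Set Ω} (hA : P A ≠ 0)
    (h : ∀ᵐ ω ∂P, ω ∈ A → ω ∈ S) : cond P A S = 1 := by
  have h1 : P A ≤ P (S ∩ A) := measure_mono_ae (by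
    filter_upwards [h] with ω hω hωA using ⟨hω hωA, hωA⟩)
  have h2 : P.restrict A S = P A := by
    refine le_antisymm ?_ (h1.trans (Measure.le_restrict_apply A S))
    calc P.restrict A S ≤ P.restrict A univ := measure_mono (subset_univ S)
      _ = P A := Measure.restrict_apply_univ A
  rw [ProbabilityTheory.cond, Measure.smul_apply, h2, smul_eq_mul,
    ENNReal.inv_mul_cancel hA (measure_ne_top P A)]

end KeplerDiffusion

theorem mainTheorem6 {Ω : Type*} [MeasurableSpace Ω] (P : Measure Ω) [IsProbabilityMeasure P]
    (e lam mu : ℝ) (he0 : 0 < e) (he1 : e < 1) (hlam : 0 < lam) (hmu : 0 < mu)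
    (δ : ℝ) (hδ0 : 0 < δ) (hδ1 : δ < 1 + e)
    (t : ℝ≥0) (ht : 0 < t) (x : KeplerDiffusion.Plane)
    (B : ℝ≥0 → Ω → KeplerDiffusion.Plane) (hB : KeplerDiffusion.IsPlanarBrownian B P)
    (eps : ℕ → ℝ) (heps : Summable fun j => eps j ^ 2)
    (X : ℕ → ℝ≥0 → Ω → KeplerDiffusion.Plane)
    (hX : ∀ j, KeplerDiffusion.IsLimitingDiffusion e lam mu (eps j) B P x t (X j))
    (X0 : ℝ≥0 → Ω → KeplerDiffusion.Plane)
    (hX0 : KeplerDiffusion.IsLimitingDiffusion e lam mu 0 B P x t X0) :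
    -- almost surely, uniform convergence along the indices `j` for which `A j` occurs
    (∀ᵐ ω ∂P,
      TendstoUniformlyOn (fun j s => X j s ω) (fun s => X0 s ω)
        (atTop ⊓ 𝓟 {j | ω ∈ KeplerDiffusion.avoidEvent e lam mu δ t (X j)}) (Ioo 0 t)) ∧
    -- conditionally on all but finitely many of the `A j`
    (P {ω | ∀ᶠ j in atTop, ω ∈ KeplerDiffusion.avoidEvent e lam mu δ t (X j)} ≠ 0 →
      cond P {ω | ∀ᶠ j in atTop, ω ∈ KeplerDiffusion.avoidEvent e lam mu δ t (X j)}
        {ω | TendstoUniformlyOn (fun j s => X j s ω) (fun s => X0 s ω) atTop (Ioo 0 t)} = 1) ∧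
    -- conditionally on each single `A j`, when the limit path does not meet the singularity
    ((∀ᵐ ω ∂P, ∀ s ≤ t, X0 s ω ∉ closure (KeplerDiffusion.singularity e lam mu)) →
      ∀ j, P (KeplerDiffusion.avoidEvent e lam mu δ t (X j)) ≠ 0 →
        cond P (KeplerDiffusion.avoidEvent e lam mu δ t (X j))
          {ω | TendstoUniformlyOn (fun k s => X k s ω) (fun s => X0 s ω) atTop (Ioo 0 t)} = 1) := by
  have htend : Tendsto eps atTop (𝓝 0) := by
    have h := heps.tendsto_atTop_zero.sqrt
    simp only [Real.sqrt_sq_eq_abs, Real.sqrt_zero] at h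
    exact (tendsto_zero_iff_abs_tendsto_zero eps).2 h
  have hlip := KeplerDiffusion.locallyLipschitzOn_drift he0 he1 hlam hmu
  have hclosed := KeplerDiffusion.isClosed_closedSingularity e lam mu
  -- the limit path avoids the singularity as soon as infinitely many of the events occur
  have key : ∀ᵐ ω ∂P,
      ((∃ᶠ j in atTop, ω ∈ KeplerDiffusion.avoidEvent e lam mu δ t (X j)) →
        ∀ s ≤ t, X0 s ω ∉ KeplerDiffusion.closedSingularity e lam mu) ∧
      ((∀ s ≤ t, X0 s ω ∉ KeplerDiffusion.closedSingularity e lam mu) →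
        TendstoUniformlyOn (fun j s => X j s ω) (fun s => X0 s ω) atTop (Ioo 0 t)) := by
    filter_upwards [hB.continuous_paths, hB.apply_zero, hX0.continuous_paths,
      hX0.integrable_drift, hX0.equation, ae_all_iff.2 fun j => (hX j).continuous_paths,
      ae_all_iff.2 fun j => (hX j).integrable_drift, ae_all_iff.2 fun j => (hX j).equation]
      with ω hw hw0 hf hfi hfe hg hgi hge
    simp only [zero_smul, add_zero] at hfe
    constructor
    · intro hfreq
      exact KeplerDiffusion.notMem_of_frequently_avoid hclosed
        (KeplerDiffusion.isOpen_intEllipse e lam mu (1 - δ))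
        (KeplerDiffusion.closedSingularity_subset_intEllipse he0 he1 hlam hmu
          (by linarith) (by linarith))
        hlip ht hw hw0 htend hf hfi hfe hg hgi hge
        (hfreq.mono fun j hj s hs0 hst => KeplerDiffusion.notMem_of_mem_avoidEvent hj hs0 hst)
    · intro hS
      exact (KeplerDiffusion.tendstoUniformlyOn_of_integral_equation hclosed.isOpen_compl hlip hw
        htend hf hfi hfe hS hg hgi hge).mono fun s hs => hs.2.le
  refine ⟨?_, fun hA => ?_, fun hS j hA => ?_⟩
  · filter_upwards [key] with ω hω
    by_cases hfreq : ∃ᶠ j in atTop, ω ∈ KeplerDiffusion.avoidEvent e lam mu δ t (X j)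
    · exact fun u hu => (hω.2 (hω.1 hfreq) u hu).filter_mono inf_le_left
    -- Only finitely many events occur, so the restricted filter is trivial and the claim is
    -- vacuous.
    · intro u _
      rw [eventually_inf_principal]
      filter_upwards [not_frequently.1 hfreq] with j hj hj'
      exact absurd hj' hj
  · refine KeplerDiffusion.cond_eq_one_of_ae hA ?_
    filter_upwards [key] with ω hω hev
    exact hω.2 (hω.1 (Eventually.frequently hev))
  · refine KeplerDiffusion.cond_eq_one_of_ae hA ?_
    filter_upwards [key, hS] with ω hω hSω _
    exact hω.2 fun s hs hmem => hSω s hs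
      (KeplerDiffusion.closedSingularity_subset_closure he0 hlam hmu hmem)
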